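/- All $C^*$-algebras below are nonzero, finite dimensional and in standard form $\mathcal A=\bigoplus_j B(\mathcal H_j)\subseteq B(\mathcal H)$, $\mathcal H=\bigoplus_j\mathcal H_j$, the block-diagonal matrices with respect to a fixed orthonormal basis $|i\rangle$ of $\mathcal H$ that is a union of bases of the $\mathcal H_j$; $\mathcal A$ carries the trace of $B(\mathcal H)$. The set $\mathfrak S(\mathcal A)$ of states consists of the positive elements of $\mathcal A$ of trace $1$. A linear map $\Phi:\mathcal A\to\mathcal B$ is completely positive (cp) if $\mathrm{id}\otimes\Phi: B(\mathbb C^k)\otimes\mathcal A\to B(\mathbb C^k)\otimes\mathcal B$ is positive for every $k$, and a channel if it is cp and trace preserving. Its Choi matrix is $X_\Phi=\sum_{i,j}\Phi(|i\rangle\langle j|)\otimes|i\rangle\langle j|\in\mathcal B\otimes\mathcal A$, the sum over all pairs $i,j$ of basis vectors of $\mathcal H$ that lie in the same block. Let $\mathcal B_0,\mathcal B_1,\mathcal B_2,\dots$ be such algebras. Generalized supermaps: $\mathcal C(\mathcal B_0,\mathcal B_1)\subseteq\mathcal B_1\otimes\mathcal B_0$ is the set of Choi matrices of channels $\mathcal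 B_0\to\mathcal B_1$, and for $n\ge 2$, $\mathcal C(\mathcal B_0,\dots,\mathcal B_n)\subseteq\mathcal B_n\otimes\dots\otimes\mathcal B_0$ is the set of Choi matrices of cp maps $\mathcal B_{n-1}\otimes\dots\otimes\mathcal B_0\to\mathcal B_n$ that send $\mathcal C(\mathcal B_0,\dots,\mathcal B_{n-1})$ into $\mathfrak S(\mathcal B_n)$. Quantum combs: $\mathrm{Comb}(\mathcal B_0,\mathcal B_1)\subseteq\mathcal B_1\otimes\mathcal B_0$, the set of $1$-combs, is the set of Choi matrices of channels $\mathcal B_0\to\mathcal B_1$. For $N\ge 2$, the set $\mathrm{Comb}(\mathcal B_0,\dots,\mathcal B_{2N-1})$ of $N$-combs is the set of Choi matrices of cp maps $\mathcal B_{2N-2}\otimes\dots\otimes\mathcal B_1\to\mathcal B_{2N-1}\otimes\mathcal B_0$ that send the set $\mathrm{Comb}(\mathcal B_1,\dots,\mathcal B_{2N-2})$ of $(N-1)$-combs into the set $\mathrm{Comb}(\mathcal B_0,\mathcal B_{2N-1})$ of $1$-combs, where the tensor factors of the Choi matrix are put in the order $\mathcal B_{2N-1}\otimes\mathcal B_{2N-2}\otimes\dots\otimes\mathcal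 B_1\otimes\mathcal B_0$. Theorem. For every $N\ge 1$, $$\mathrm{Comb}(\mathcal B_0,\dots,\mathcal B_{2N-1})=\mathcal C(\mathcal B_0,\dots,\mathcal B_{2N-1})$$ as subsets of $\mathcal B_{2N-1}\otimes\dots\otimes\mathcal B_0$. -/

import Mathlib

universe u

/-- A nonzero finite-dimensional `C*`-algebra in its standard form `⊕ⱼ B(Hⱼ) ⊆ B(⊕ⱼ Hⱼ)`.
`ι` indexes the canonical orthonormal basis of `H = ⊕ⱼ Hⱼ`, and `blk i = j` says that the basis
vector `i` lies in the summand `Hⱼ`. -/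
structure FDAlg : Type (u + 1) where
  ι : Type u
  κ : Type u
  [fintypeι : Fintype ι]
  [decEqι : DecidableEq ι]
  [nonemptyι : Nonempty ι]
  blk : ι → κ

namespace FDAlg

open scoped ComplexOrder

instance (A : FDAlg.{u}) : Fintype A.ι := A.fintypeι
instance (A : FDAlg.{u}) : DecidableEq A.ι := A.decEqι
instance (A : FDAlg.{u}) : Nonempty A.ι := A.nonemptyι

/-- The algebra itself: the `*`-algebra of block-diagonal matrices. -/
def alg (A : FDAlg.{u}) : StarSubalgebra ℂ (Matrix A.ι A.ι ℂ) where
  carrier := {M | ∀ i j, A.blk i ≠ A.blk j → M i j = 0}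
  mul_mem' := by
    intro M M' hM hM' i j hij
    rw [Matrix.mul_apply]
    refine Finset.sum_eq_zero fun l _ => ?_
    by_cases h : A.blk i = A.blk l
    · rw [hM' l j (fun h' => hij (h.trans h')), mul_zero]
    · rw [hM i l h, zero_mul]
  add_mem' := by
    intro M M' hM hM' i j hij
    rw [Matrix.add_apply, hM i j hij, hM' i j hij, add_zero]
  algebraMap_mem' := by
    intro r i j hij
    rw [Matrix.algebraMap_matrix_apply, if_neg (fun h => hij (congrArg A.blk h))]
  star_mem' := by
    intro M hM i j hij
    rw [Matrix.star_apply, hM j i (Ne.symm hij), star_zero]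

/-- The tensor product `A ⊗ B = ⊕ᵢⱼ B(Hᵢ ⊗ Kⱼ)`. -/
def tensor (A B : FDAlg.{u}) : FDAlg.{u} where
  ι := A.ι × B.ι
  κ := A.κ × B.κ
  fintypeι := inferInstance
  decEqι := inferInstance
  nonemptyι := inferInstance
  blk := Prod.map A.blk B.blk

/-- The matrix unit `|i⟩⟨j|` as an element of the algebra when `i`, `j` lie in the same block
(and `0` otherwise). -/
noncomputable def unit (A : FDAlg.{u}) (i j : A.ι) : A.alg :=
  open Classical in
  if h : A.blk i = A.blk j then
    ⟨Matrix.single i j 1, by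
      intro p q hpq
      rw [Matrix.single_apply, if_neg]
      rintro ⟨rfl, rfl⟩
      exact hpq h⟩
  else 0

/-- The states of `A`, as density operators. -/
def states (A : FDAlg.{u}) : Set A.alg :=
  {ρ | (ρ : Matrix A.ι A.ι ℂ).PosSemidef ∧ (ρ : Matrix A.ι A.ι ℂ).trace = 1}

/-- Complete positivity: `id ⊗ Φ : B(ℂᵏ) ⊗ A → B(ℂᵏ) ⊗ B` is positive for every `k`. -/
def IsCP {A B : FDAlg.{u}} (Φ : A.alg →ₗ[ℂ] B.alg) : Prop :=
  ∀ (k : ℕ) (M : Matrix (Fin k) (Fin k) A.alg),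
    (Matrix.comp (Fin k) (Fin k) A.ι A.ι ℂ
      (M.map fun a => (a : Matrix A.ι A.ι ℂ))).PosSemidef →
    (Matrix.comp (Fin k) (Fin k) B.ι B.ι ℂ
      (M.map fun a => (Φ a : Matrix B.ι B.ι ℂ))).PosSemidef

/-- A channel: a completely positive trace-preserving map. -/
def IsChannel {A B : FDAlg.{u}} (Φ : A.alg →ₗ[ℂ] B.alg) : Prop :=
  IsCP Φ ∧ ∀ a : A.alg,
    (Φ a : Matrix B.ι B.ι ℂ).trace = (a : Matrix A.ι A.ι ℂ).trace

/-- The Choi matrix `∑ Φ(|i⟩⟨j|) ⊗ |i⟩⟨j| ∈ B ⊗ A`, the sum over pairs `i, j` of canonical basis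
vectors in a common block of `A`. -/
noncomputable def choi {A B : FDAlg.{u}} (Φ : A.alg →ₗ[ℂ] B.alg) : (tensor B A).alg :=
  ⟨fun x y => (Φ (A.unit x.2 y.2) : Matrix B.ι B.ι ℂ) x.1 y.1, by
    rintro ⟨p, i⟩ ⟨q, j⟩ hne
    by_cases h : A.blk i = A.blk j
    · exact (Φ (A.unit i j)).2 p q fun h' => hne (Prod.ext h' h)
    · have h0 : A.unit i j = 0 := by rw [unit, dif_neg h]
      change (Φ (A.unit i j) : Matrix B.ι B.ι ℂ) p q = 0
      rw [h0, map_zero]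
      rfl⟩

/-- The set of Choi matrices of channels `A → B`, a subset of `B ⊗ A`. -/
def channels (A B : FDAlg.{u}) : Set (tensor B A).alg :=
  {X | ∃ Φ : A.alg →ₗ[ℂ] B.alg, IsChannel Φ ∧ X = choi Φ}

/-- `tensorUpTo B n = B n ⊗ B (n - 1) ⊗ ⋯ ⊗ B 0`. -/
def tensorUpTo (B : ℕ → FDAlg.{u}) : ℕ → FDAlg.{u}
  | 0 => B 0
  | n + 1 => tensor (B (n + 1)) (tensorUpTo B n)

/-- The shifted sequence `B 1, B 2, …`. -/
def shift (B : ℕ → FDAlg.{u}) : ℕ → FDAlg.{u} := fun n => B (n + 1)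

/-- The generalized supermaps: `supermaps B n` is the set `𝒞(B 0, …, B (n + 1))`, a subset of
`B (n + 1) ⊗ ⋯ ⊗ B 0`. It starts with the channels `B 0 → B 1`; next come the Choi matrices of
the cp maps which send `𝒞(B 0, …, B (n + 1))` into the states of `B (n + 2)`. -/
def supermaps (B : ℕ → FDAlg.{u}) : (n : ℕ) → Set (tensorUpTo B (n + 1)).alg
  | 0 => channels (B 0) (B 1)
  | n + 1 => {X | ∃ Φ : (tensorUpTo B (n + 1)).alg →ₗ[ℂ] (B (n + 2)).alg,
      IsCP Φ ∧ (∀ Y ∈ supermaps B n, Φ Y ∈ (B (n + 2)).states) ∧ X = choi Φ}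

/-- The re-bracketing `B (n + 1) ⊗ (⋯ ⊗ (B 1 ⊗ B 0)) ≃ (B (n + 1) ⊗ ⋯ ⊗ B 1) ⊗ B 0`, on basis
indices. -/
def splitFirst (B : ℕ → FDAlg.{u}) :
    (n : ℕ) → (tensorUpTo B (n + 1)).ι ≃ (tensorUpTo (shift B) n).ι × (B 0).ι
  | 0 => Equiv.refl ((B 1).ι × (B 0).ι)
  | n + 1 => ((Equiv.refl (B (n + 2)).ι).prodCongr (splitFirst B n)).trans
      (Equiv.prodAssoc (B (n + 2)).ι (tensorUpTo (shift B) n).ι (B 0).ι).symm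

/-- The re-ordering `C ⊗ (A ⊗ B 0) ≃ (C ⊗ B 0) ⊗ A` on basis indices, with
`A = B (n + 1) ⊗ ⋯ ⊗ B 1` and `C = B (n + 2)`. -/
def combIndex (B : ℕ → FDAlg.{u}) (n : ℕ) :
    (tensorUpTo B (n + 2)).ι ≃
      (tensor (tensor (B (n + 2)) (B 0)) (tensorUpTo (shift B) n)).ι :=
  ((Equiv.refl (B (n + 2)).ι).prodCongr
      ((splitFirst B n).trans (Equiv.prodComm (tensorUpTo (shift B) n).ι (B 0).ι))).trans
    (Equiv.prodAssoc (B (n + 2)).ι (B 0).ι (tensorUpTo (shift B) n).ι).symm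

/-- The quantum combs: `combs k B` is the set of quantum `(k + 1)`-combs on
`(B 0, …, B (2 * k + 1))`. A `1`-comb is the Choi matrix of a channel `B 0 → B 1`; a `(k + 2)`-comb
is the Choi matrix of a cp map which sends the `(k + 1)`-combs on `(B 1, …, B (2 * k + 2))` to
`1`-combs on `(B 0, B (2 * k + 3))`, its tensor factors put in the order
`B (2 * k + 3) ⊗ ⋯ ⊗ B 0`. -/
def combs : (k : ℕ) → (B : ℕ → FDAlg.{u}) → Set (tensorUpTo B (2 * k + 1)).alg
  | 0, B => channels (B 0) (B 1)
  | k + 1, B => {X | ∃ Φ : (tensorUpTo (shift B) (2 * k + 1)).alg →ₗ[ℂ]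
        (tensor (B (2 * k + 3)) (B 0)).alg,
      IsCP Φ ∧
      (∀ Y ∈ combs k (shift B), Φ Y ∈ channels (B 0) (B (2 * k + 3))) ∧
      X.1 = (choi Φ).1.submatrix (combIndex B (2 * k + 1)) (combIndex B (2 * k + 1))}

end FDAlg

set_option linter.unusedSectionVars false

open Matrix
open scoped ComplexOrder Kronecker

/-! Both families are obtained from one operation. A cp map is contraction with its positive Choi
matrix `X`, and the trace of its value at `Y` is the pairing of `ptrace X` with `Y`. Sending a set
`S` of positive elements to states therefore means that `ptrace X` lies in `dual S`, that is, `X ∈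
lift S`. Hence generalized supermaps are the iterated lifts of the states of `B 0`
(`mem_supermaps_iff`).

For combs, the crux is that the dual of `lift S` is `1 ⊗ S` when `S` is regular
(`mem_dual_lift_iff`). Regularity holds for states and survives lifting, so two lifts up from `S`
the condition is just `ptrace X = 1 ⊗ Y` with `Y ∈ S`. This condition commutes with contracting the
factor `B 0` against a state, and such contractions separate elements. By induction in steps of two,
`X` is an odd iterated lift exactly when all its contractions at `B 0` are even iterated lifts for
`B 1, B 2, …` (`mem_iterLift_odd_iff`). The comb condition says the same: feeding in a shorter comb
and then a state of `B 0` gives trace one, and the two contractions may be done in either order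
(`pair_ptrace_slice`). -/

namespace BlockMatrix

/-! ### Positive cones, the bilinear pairing and the partial trace -/

variable {α β γ κ l : Type*} [Fintype α] [Fintype β] [Fintype γ]

/-- The positive semidefinite matrices which are block diagonal with respect to `b`. -/
def posCone (b : α → κ) : Set (Matrix α α ℂ) :=
  {M | (∀ i j, b i ≠ b j → M i j = 0) ∧ M.PosSemidef}

/-- The bilinear pairing `∑ᵢⱼ Mᵢⱼ Nᵢⱼ`. -/
def pair (M N : Matrix α α ℂ) : ℂ := ∑ i, ∑ j, M i j * N i j

theorem pair_comm (M N : Matrix α α ℂ) : pair M N = pair N M := by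
  simp only [pair, mul_comm]

theorem pair_add_right (M N N' : Matrix α α ℂ) : pair M (N + N') = pair M N + pair M N' := by
  simp only [pair, Matrix.add_apply, mul_add, Finset.sum_add_distrib]

theorem pair_smul_right (c : ℂ) (M N : Matrix α α ℂ) : pair M (c • N) = c * pair M N := by
  simp only [pair, Matrix.smul_apply, smul_eq_mul, mul_left_comm, Finset.mul_sum]

theorem pair_sub_left (M M' N : Matrix α α ℂ) : pair (M - M') N = pair M N - pair M' N := by
  simp only [pair, Matrix.sub_apply, sub_mul, Finset.sum_sub_distrib]

theorem pair_one [DecidableEq α] (M : Matrix α α ℂ) : pair M 1 = M.trace := by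
  simp [pair, Matrix.one_apply, Matrix.trace]

theorem pair_single [DecidableEq α] (M : Matrix α α ℂ) (i j : α) (c : ℂ) :
    pair M (Matrix.single i j c) = M i j * c := by
  simp only [pair, Matrix.single_apply, ite_and, mul_ite, mul_zero]
  simp

theorem pair_transpose_self (M : Matrix α α ℂ) : pair M Mᵀ = (M * M).trace := by
  simp [pair, Matrix.trace, Matrix.mul_apply]

/-- The partial trace over the first tensor factor. -/
def ptrace (X : Matrix (β × α) (β × α) ℂ) : Matrix α α ℂ :=
  Matrix.of fun i j => ∑ p, X (p, i) (p, j)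

theorem ptrace_add (X Y : Matrix (β × α) (β × α) ℂ) : ptrace (X + Y) = ptrace X + ptrace Y := by
  ext i j; simp [ptrace, Finset.sum_add_distrib]

theorem ptrace_sub (X Y : Matrix (β × α) (β × α) ℂ) : ptrace (X - Y) = ptrace X - ptrace Y := by
  ext i j; simp [ptrace]

theorem ptrace_smul (c : ℂ) (X : Matrix (β × α) (β × α) ℂ) : ptrace (c • X) = c • ptrace X := by
  ext i j; simp [ptrace, Finset.mul_sum]

theorem ptrace_transpose (X : Matrix (β × α) (β × α) ℂ) : ptrace Xᵀ = (ptrace X)ᵀ := rfl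

theorem ptrace_one_kronecker [DecidableEq β] (Y : Matrix α α ℂ) :
    ptrace ((1 : Matrix β β ℂ) ⊗ₖ Y) = (Fintype.card β : ℂ) • Y := by
  ext i j; simp [ptrace]

theorem pair_one_kronecker [DecidableEq β] (Y : Matrix α α ℂ) (X : Matrix (β × α) (β × α) ℂ) :
    pair ((1 : Matrix β β ℂ) ⊗ₖ Y) X = pair Y (ptrace X) := by
  simp only [pair, ptrace, Fintype.sum_prod_type, Matrix.kroneckerMap_apply, Matrix.one_apply,
    Matrix.of_apply, ite_mul, one_mul, zero_mul, Finset.mul_sum]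
  rw [Finset.sum_comm]
  refine Finset.sum_congr rfl fun i _ => ?_
  rw [Finset.sum_comm (s := Finset.univ (α := α))]
  refine Finset.sum_congr rfl fun p _ => ?_
  rw [Finset.sum_comm]
  simp

theorem smul_mem_posCone {b : α → κ} {M : Matrix α α ℂ} (hM : M ∈ posCone b) {c : ℂ}
    (hc : 0 ≤ c) : c • M ∈ posCone b :=
  ⟨fun i j h => by simp [hM.1 i j h], hM.2.smul hc⟩

theorem one_mem_posCone [DecidableEq α] (b : α → κ) : (1 : Matrix α α ℂ) ∈ posCone b :=
  ⟨fun _ _ h => Matrix.one_apply_ne fun e => h (e ▸ rfl), Matrix.PosSemidef.one⟩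

theorem ptrace_mem_posCone {b : α → κ} {b' : β → l} {X : Matrix (β × α) (β × α) ℂ}
    (hX : X ∈ posCone (Prod.map b' b)) : ptrace X ∈ posCone b := by
  refine ⟨fun i j h => ?_, ?_⟩
  · exact Finset.sum_eq_zero fun p _ => hX.1 _ _ fun e => h (congrArg Prod.snd e)
  · have : ptrace X = ∑ p, X.submatrix (Prod.mk p) (Prod.mk p) := by
      ext i j; simp [ptrace, Matrix.sum_apply]
    rw [this]
    exact Matrix.posSemidef_sum _ fun p _ => hX.2.submatrix _

theorem one_kronecker_mem_posCone [DecidableEq β] {b : α → κ} (b' : β → l) {Y : Matrix α α ℂ}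
    (hY : Y ∈ posCone b) : (1 : Matrix β β ℂ) ⊗ₖ Y ∈ posCone (Prod.map b' b) := by
  refine ⟨?_, Matrix.PosSemidef.one.kronecker hY.2⟩
  rintro ⟨p, i⟩ ⟨q, j⟩ h
  by_cases hpq : p = q
  · subst hpq
    simp [hY.1 i j fun e => h (Prod.ext rfl e)]
  · simp [hpq]

/-! ### Duals, lifts and regular sets -/

/-- The positive block-diagonal matrices which pair to `1` with every element of `S`. -/
def dual (b : α → κ) (S : Set (Matrix α α ℂ)) : Set (Matrix α α ℂ) :=
  {Z | Z ∈ posCone b ∧ ∀ X ∈ S, pair Z X = 1}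

/-- The positive block-diagonal matrices with partial trace in the dual of `S`. -/
def lift (b' : β → l) (b : α → κ) (S : Set (Matrix α α ℂ)) : Set (Matrix (β × α) (β × α) ℂ) :=
  {X | X ∈ posCone (Prod.map b' b) ∧ ptrace X ∈ dual b S}

/-- The density matrices. -/
def stateSet (b : α → κ) : Set (Matrix α α ℂ) := {ρ | ρ ∈ posCone b ∧ ρ.trace = 1}

/-- A set which equals its bidual and which, as well as its dual, contains a positive multiple of
the identity. -/
structure IsRegular [DecidableEq α] (b : α → κ) (S : Set (Matrix α α ℂ)) : Prop where
  bidual : dual b (dual b S) = S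
  smul_one_mem : ∃ c : ℂ, 0 < c ∧ c • (1 : Matrix α α ℂ) ∈ S
  smul_one_mem_dual : ∃ c : ℂ, 0 < c ∧ c • (1 : Matrix α α ℂ) ∈ dual b S

theorem card_pos_complex [Nonempty β] : (0 : ℂ) < Fintype.card β := by
  exact_mod_cast Fintype.card_pos

-- Since `-‖H‖ ≤ H`, the constant `‖H‖ + 1` works; the extra `1` keeps it strictly positive when `H
-- = 0`.
open scoped MatrixOrder Matrix.Norms.L2Operator in
theorem exists_posSemidef_smul_one_add [DecidableEq α] {H : Matrix α α ℂ} (hH : H.IsHermitian) :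
    ∃ c : ℂ, 0 < c ∧ (c • (1 : Matrix α α ℂ) + H).PosSemidef := by
  have h := IsSelfAdjoint.neg_algebraMap_norm_le_self (a := H) hH
  rw [Matrix.le_iff] at h
  refine ⟨((‖H‖ + 1 : ℝ) : ℂ), by exact_mod_cast (by positivity : (0 : ℝ) < ‖H‖ + 1), ?_⟩
  have e : ((‖H‖ + 1 : ℝ) : ℂ) • (1 : Matrix α α ℂ) + H =
      (H - -(algebraMap ℝ (Matrix α α ℂ)) ‖H‖) + 1 := by
    rw [Algebra.algebraMap_eq_smul_one]
    ext i j
    simp only [Matrix.add_apply, Matrix.sub_apply, Matrix.neg_apply, Matrix.smul_apply,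
      smul_eq_mul, Complex.real_smul]
    push_cast
    ring
  rw [e]
  exact h.add Matrix.PosSemidef.one

section lift

variable [DecidableEq α] [DecidableEq β] [Nonempty β] {b : α → κ} {b' : β → l}
  {S : Set (Matrix α α ℂ)}

theorem smul_one_mem_lift {c : ℂ} (hc : 0 < c) (h : c • (1 : Matrix α α ℂ) ∈ dual b S) :
    (c / Fintype.card β) • (1 : Matrix (β × α) (β × α) ℂ) ∈ lift b' b S := by
  have hd := card_pos_complex (β := β)
  refine ⟨smul_mem_posCone (one_mem_posCone _) (div_nonneg hc.le hd.le), ?_⟩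
  rwa [ptrace_smul, ← Matrix.one_kronecker_one, ptrace_one_kronecker, smul_smul,
    div_mul_cancel₀ _ hd.ne']

theorem one_kronecker_mem_lift {X : Matrix α α ℂ} (h : X ∈ dual b S) :
    (Fintype.card β : ℂ)⁻¹ • ((1 : Matrix β β ℂ) ⊗ₖ X) ∈ lift b' b S := by
  have hd := card_pos_complex (β := β)
  refine ⟨smul_mem_posCone (one_kronecker_mem_posCone _ h.1) (inv_nonneg.2 hd.le), ?_⟩
  rwa [ptrace_smul, ptrace_one_kronecker, smul_smul, inv_mul_cancel₀ hd.ne', one_smul]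

theorem one_kronecker_mem_dual_lift {Y : Matrix α α ℂ} (hY : Y ∈ posCone b) (h : Y ∈ S) :
    (1 : Matrix β β ℂ) ⊗ₖ Y ∈ dual (Prod.map b' b) (lift b' b S) :=
  ⟨one_kronecker_mem_posCone _ hY, fun X hX => by
    rw [pair_one_kronecker, pair_comm]; exact hX.2.2 Y h⟩

/-- The duality theorem: the dual of `lift S` is `1 ⊗ S`. -/
theorem mem_dual_lift_iff (hS : IsRegular b S) {Z : Matrix (β × α) (β × α) ℂ} :
    Z ∈ dual (Prod.map b' b) (lift b' b S) ↔ ∃ Y ∈ S, Z = (1 : Matrix β β ℂ) ⊗ₖ Y := by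
  have hd := card_pos_complex (β := β)
  constructor
  · intro hZ
    -- The only possible choice of `Y`: it makes the remainder `W` have zero partial trace.
    set Y : Matrix α α ℂ := (Fintype.card β : ℂ)⁻¹ • ptrace Z with hY
    have hYp : Y ∈ posCone b := smul_mem_posCone (ptrace_mem_posCone hZ.1) (inv_nonneg.2 hd.le)
    set W : Matrix (β × α) (β × α) ℂ := Z - (1 : Matrix β β ℂ) ⊗ₖ Y with hW
    have hYk := one_kronecker_mem_posCone b' hYp
    have hWt : ptrace W = 0 := by
      rw [hW, ptrace_sub, ptrace_one_kronecker, hY, smul_smul, mul_inv_cancel₀ hd.ne', one_smul,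
        sub_self]
    have hWh : W.IsHermitian := hZ.1.2.1.sub hYk.2.1
    have hWb : ∀ x y, Prod.map b' b x ≠ Prod.map b' b y → W x y = 0 := fun x y h => by
      rw [hW, Matrix.sub_apply, hZ.1.1 x y h, hYk.1 x y h, sub_zero]
    obtain ⟨c, hc, hcS⟩ := hS.smul_one_mem_dual
    obtain ⟨e, he, hpos⟩ := exists_posSemidef_smul_one_add hWh.transpose
    have hmem := smul_one_mem_lift (b' := b') hc hcS
    set c₀ : ℂ := c / Fintype.card β
    have hc₀ : 0 < c₀ := div_pos hc hd
    -- A multiple of `1` can absorb a small Hermitian perturbation, and `Wᵀ` has zero partial trace,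
    -- so the perturbed point stays in the lift. Both points pair to `1` with `Z`, hence `Z`
    -- annihilates `Wᵀ`.
    have hmem' : c₀ • (1 : Matrix (β × α) (β × α) ℂ) + (c₀ / e) • Wᵀ ∈ lift b' b S := by
      refine ⟨⟨fun x y h => ?_, ?_⟩, ?_⟩
      · rw [Matrix.add_apply, hmem.1.1 x y h, Matrix.smul_apply, Matrix.transpose_apply,
          hWb y x h.symm, smul_zero, add_zero]
      · convert hpos.smul (div_nonneg hc₀.le he.le) using 1
        rw [smul_add, smul_smul, div_mul_cancel₀ _ he.ne']
      · rw [ptrace_add, ptrace_smul (c₀ / e), ptrace_transpose, hWt, Matrix.transpose_zero,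
          smul_zero, add_zero]
        exact hmem.2
    have h1 := hZ.2 _ hmem
    have h2 := hZ.2 _ hmem'
    rw [pair_add_right, h1, pair_smul_right, add_eq_left] at h2
    have h3 : pair Z Wᵀ = 0 := (mul_eq_zero.1 h2).resolve_left (div_pos hc₀ he).ne'
    -- The part `1 ⊗ Y` also annihilates `Wᵀ`, so `tr (W * W) = 0` with `W` Hermitian.
    have h4 : pair W Wᵀ = 0 := by
      rw [hW, pair_sub_left, ← hW, h3, pair_one_kronecker, ptrace_transpose, hWt]
      simp [pair]
    have hW0 : W = 0 := by
      rw [pair_transpose_self] at h4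
      refine Matrix.trace_conjTranspose_mul_self_eq_zero_iff.1 ?_
      rwa [hWh.eq]
    have hZY : Z = (1 : Matrix β β ℂ) ⊗ₖ Y := sub_eq_zero.1 hW0
    refine ⟨Y, ?_, hZY⟩
    -- By the bidual property it suffices to test `Y` on `dual b S`, each element of which gives a
    -- normalized `1 ⊗ X` in the lift.
    rw [← hS.bidual]
    refine ⟨hYp, fun X hX => ?_⟩
    have := hZ.2 _ (one_kronecker_mem_lift (b' := b') hX)
    rwa [hZY, pair_one_kronecker, ptrace_smul, ptrace_one_kronecker, smul_smul,
      inv_mul_cancel₀ hd.ne', one_smul] at this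
  · rintro ⟨Y, hY, rfl⟩
    refine one_kronecker_mem_dual_lift ?_ hY
    rw [← hS.bidual] at hY
    exact hY.1

/-- With the dual known to be `1 ⊗ S`, the bidual condition on `X` only tests `ptrace X` against
`S`. The multiples of `1` in the set and in its dual exchange roles. -/
theorem IsRegular.lift (hS : IsRegular b S) : IsRegular (Prod.map b' b) (lift b' b S) where
  bidual := by
    ext X
    refine and_congr_right fun hX => ⟨fun h => ⟨ptrace_mem_posCone hX, fun Y hY => ?_⟩,
      fun h Z hZ => ?_⟩
    · rw [pair_comm, ← pair_one_kronecker, pair_comm]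
      exact h _ ((mem_dual_lift_iff hS).2 ⟨Y, hY, rfl⟩)
    · obtain ⟨Y, hY, rfl⟩ := (mem_dual_lift_iff hS).1 hZ
      rw [pair_comm, pair_one_kronecker, pair_comm]
      exact h.2 Y hY
  smul_one_mem :=
    let ⟨c, hc, h⟩ := hS.smul_one_mem_dual
    ⟨_, div_pos hc card_pos_complex, smul_one_mem_lift hc h⟩
  smul_one_mem_dual := by
    obtain ⟨c, hc, h⟩ := hS.smul_one_mem
    refine ⟨c, hc, (mem_dual_lift_iff hS).2 ⟨_, h, ?_⟩⟩
    rw [Matrix.kronecker_smul, Matrix.one_kronecker_one]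

end lift

/-! ### States separate block-diagonal matrices -/

section states

theorem pair_eq_zero_of_states {b : α → κ} {D : Matrix α α ℂ}
    (h : ∀ ρ ∈ stateSet b, pair D ρ = 0) {ρ : Matrix α α ℂ} (hρ : ρ ∈ posCone b) :
    pair D ρ = 0 := by
  by_cases ht : ρ.trace = 0
  · rw [hρ.2.trace_eq_zero_iff.1 ht]
    simp [pair]
  · have := h (ρ.trace⁻¹ • ρ) ⟨smul_mem_posCone hρ (inv_nonneg.2 hρ.2.trace_nonneg), by
      rw [Matrix.trace_smul, smul_eq_mul, inv_mul_cancel₀ ht]⟩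
    rw [pair_smul_right] at this
    exact (mul_eq_zero.1 this).resolve_left (inv_ne_zero ht)

variable [DecidableEq α]

theorem vecMulVec_single_single (i j : α) (x y : ℂ) :
    Matrix.vecMulVec (Pi.single i x) (Pi.single j y) = Matrix.single i j (x * y) := by
  ext k m
  by_cases hk : i = k <;> by_cases hm : j = m <;>
    simp [Matrix.vecMulVec_apply, hk, hm, eq_comm (b := i), eq_comm (b := j)]

/-- Polarization: the rank-one matrices of the vectors `eᵢ + z eⱼ`, with `i`, `j` in one block and
`z = 0, 1, I`, determine every entry inside the blocks. -/
theorem eq_of_pair_states {b : α → κ} {T T' : Matrix α α ℂ}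
    (hT : ∀ i j, b i ≠ b j → T i j = T' i j)
    (h : ∀ ρ ∈ stateSet b, pair T ρ = pair T' ρ) : T = T' := by
  have h0 : ∀ ρ ∈ stateSet b, pair (T - T') ρ = 0 := fun ρ hρ => by
    rw [pair_sub_left, h ρ hρ, sub_self]
  have key : ∀ i j, b i = b j → ∀ z : ℂ, (T - T') i i + (T - T') i j * star z +
      ((T - T') j i * z + (T - T') j j * (z * star z)) = 0 := by
    intro i j hij z
    set v : α → ℂ := Pi.single i 1 + Pi.single j z with hv
    have hρ : Matrix.vecMulVec v (star v) = Matrix.single i i 1 + Matrix.single i j (star z) +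
        (Matrix.single j i z + Matrix.single j j (z * star z)) := by
      rw [hv, star_add, Pi.star_single, Pi.star_single, Matrix.add_vecMulVec,
        Matrix.vecMulVec_add, Matrix.vecMulVec_add]
      simp only [vecMulVec_single_single, star_one, mul_one, one_mul]
    have hmem : Matrix.vecMulVec v (star v) ∈ posCone b := by
      refine ⟨fun k m hkm => ?_, Matrix.posSemidef_vecMulVec_self_star v⟩
      rw [hρ]
      simp only [Matrix.add_apply, Matrix.single_apply]
      rw [if_neg, if_neg, if_neg, if_neg]
      · simp
      all_goals
        rintro ⟨rfl, rfl⟩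
        first | exact hkm rfl | exact hkm hij | exact hkm hij.symm
    have := pair_eq_zero_of_states h0 hmem
    rw [hρ, pair_add_right, pair_add_right, pair_add_right] at this
    simpa only [pair_single, mul_one] using this
  ext i j
  by_cases hij : b i = b j
  · have hi := key i i rfl 0
    have hj := key j j rfl 0
    have h1 := key i j hij 1
    have h2 := key i j hij Complex.I
    simp only [star_zero, mul_zero, add_zero] at hi hj
    simp only [hi, hj, star_one, mul_one, zero_add, zero_mul, add_zero, Complex.star_def,
      Complex.conj_I] at h1 h2
    have h3 : (T - T') i j = 0 := by
      linear_combination (1 / 2) * h1 + (Complex.I / 2) * h2 +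
        (1 / 2 * ((T - T') i j - (T - T') j i)) * Complex.I_mul_I
    exact sub_eq_zero.1 h3
  · exact hT i j hij

theorem dual_stateSet (b : α → κ) : dual b (stateSet b) = {1} := by
  ext Z
  constructor
  · intro hZ
    refine eq_of_pair_states (b := b) (fun i j h => ?_) fun ρ hρ => ?_
    · rw [hZ.1.1 i j h, (one_mem_posCone b).1 i j h]
    · rw [hZ.2 ρ hρ, pair_comm, pair_one, hρ.2]
  · rintro rfl
    exact ⟨one_mem_posCone b, fun ρ hρ => by rw [pair_comm, pair_one, hρ.2]⟩

theorem isRegular_stateSet [Nonempty α] (b : α → κ) : IsRegular b (stateSet b) where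
  bidual := by
    rw [dual_stateSet]
    ext Z
    simp [dual, stateSet, pair_one]
  smul_one_mem := by
    have hd := card_pos_complex (β := α)
    refine ⟨(Fintype.card α : ℂ)⁻¹, inv_pos.2 hd,
      smul_mem_posCone (one_mem_posCone b) (inv_nonneg.2 hd.le), ?_⟩
    rw [Matrix.trace_smul, Matrix.trace_one, smul_eq_mul, inv_mul_cancel₀ hd.ne']
  smul_one_mem_dual := ⟨1, one_pos, by rw [one_smul, dual_stateSet]; rfl⟩

end states

/-! ### Contraction of a tensor factor -/

section slice

/-- The contraction of the second tensor factor of `X` with `ρ`. -/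
def slice (X : Matrix (β × α) (β × α) ℂ) (ρ : Matrix α α ℂ) : Matrix β β ℂ :=
  Matrix.of fun x y => ∑ i, ∑ j, X (x, i) (y, j) * ρ i j

/-- The contraction is a compression of `X ⊗ M`: restrict to equal `α`-indices, then sum over them
by conjugating with `T`. The factor `γ` serves as the ancilla in complete positivity. -/
theorem posSemidef_contract {X : Matrix (β × α) (β × α) ℂ} {M : Matrix (γ × α) (γ × α) ℂ}
    (hX : X.PosSemidef) (hM : M.PosSemidef) :
    (Matrix.of fun x y : γ × β => ∑ i, ∑ j,
      X (x.2, i) (y.2, j) * M (x.1, i) (y.1, j)).PosSemidef := by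
  classical
  let T : Matrix ((γ × β) × α) (γ × β) ℂ := Matrix.of fun x y => if x.1 = y then 1 else 0
  have h := ((hX.kronecker hM).submatrix
    fun x : (γ × β) × α => ((x.1.2, x.2), (x.1.1, x.2))).conjTranspose_mul_mul_same T
  refine (congrArg Matrix.PosSemidef ?_).mpr h
  ext x y
  simp only [Matrix.mul_apply, Matrix.of_apply, Matrix.conjTranspose_apply, T,
    Fintype.sum_prod_type (α₁ := γ × β), Matrix.submatrix_apply, Matrix.kroneckerMap_apply]
  simp only [apply_ite star, star_one, star_zero, ite_mul, one_mul, zero_mul, mul_ite, mul_one,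
    mul_zero]
  rw [Finset.sum_eq_single y]
  · simp only [if_true]
    rw [Finset.sum_comm]
    refine Finset.sum_congr rfl fun j _ => ?_
    rw [Finset.sum_eq_single x]
    · simp
    · intro z _ hz; simp [hz]
    · simp
  · intro z _ hz; simp [hz]
  · simp

theorem slice_mem_posCone {b : α → κ} {b' : β → l} {X : Matrix (β × α) (β × α) ℂ}
    (hX : X ∈ posCone (Prod.map b' b)) {ρ : Matrix α α ℂ} (hρ : ρ ∈ posCone b) :
    slice X ρ ∈ posCone b' := by
  refine ⟨fun x y h => ?_, ?_⟩
  · refine Finset.sum_eq_zero fun i _ => Finset.sum_eq_zero fun j _ => ?_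
    rw [hX.1 (x, i) (y, j) fun e => h (congrArg Prod.fst e), zero_mul]
  · exact (posSemidef_contract hX.2
      (hρ.2.submatrix (Prod.snd : Unit × α → α))).submatrix fun x : β => ((), x)

theorem trace_slice (X : Matrix (β × α) (β × α) ℂ) (ρ : Matrix α α ℂ) :
    (slice X ρ).trace = pair (ptrace X) ρ := by
  simp only [Matrix.trace, Matrix.diag, slice, pair, ptrace, Matrix.of_apply, Finset.sum_mul]
  rw [Finset.sum_comm]
  exact Finset.sum_congr rfl fun i _ => Finset.sum_comm

end slice

end BlockMatrix

/-! ### Choi matrices, channels and supermaps -/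

namespace FDAlg

open BlockMatrix

theorem mem_posCone_iff {A : FDAlg.{u}} (a : A.alg) :
    (a : Matrix A.ι A.ι ℂ) ∈ posCone A.blk ↔ (a : Matrix A.ι A.ι ℂ).PosSemidef :=
  and_iff_right a.2

theorem mem_states_iff {A : FDAlg.{u}} (a : A.alg) :
    a ∈ A.states ↔ (a : Matrix A.ι A.ι ℂ) ∈ stateSet A.blk :=
  and_congr_left fun _ => (mem_posCone_iff a).symm

theorem unit_apply (A : FDAlg.{u}) (i j k m : A.ι) :
    (A.unit i j : Matrix A.ι A.ι ℂ) k m =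
      open Classical in if A.blk i = A.blk j ∧ i = k ∧ j = m then 1 else 0 := by
  by_cases h : A.blk i = A.blk j
  · rw [unit, dif_pos h]
    simp [Matrix.single_apply, h]
  · rw [unit, dif_neg h]
    simp [h]

theorem eq_sum_unit {A : FDAlg.{u}} (a : A.alg) :
    a = ∑ i, ∑ j, (a : Matrix A.ι A.ι ℂ) i j • A.unit i j := by
  ext k m
  simp only [AddSubmonoidClass.coe_finsetSum, Matrix.sum_apply, SetLike.val_smul,
    Matrix.smul_apply, unit_apply, smul_eq_mul]
  rw [Finset.sum_eq_single k, Finset.sum_eq_single m]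
  · by_cases h : A.blk k = A.blk m
    · simp [h]
    · simp [h, a.2 k m h]
  · intro j _ hj; simp [hj]
  · simp
  · intro i _ hi; simp [hi]
  · simp

/-- A linear map is the contraction with its Choi matrix. -/
theorem coe_apply_eq_slice {A B : FDAlg.{u}} (Φ : A.alg →ₗ[ℂ] B.alg) (a : A.alg) :
    (Φ a : Matrix B.ι B.ι ℂ) = slice (choi Φ).1 (a : Matrix A.ι A.ι ℂ) := by
  ext p q
  conv_lhs => rw [eq_sum_unit a]
  simp only [map_sum, map_smul, AddSubmonoidClass.coe_finsetSum, Matrix.sum_apply,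
    SetLike.val_smul, Matrix.smul_apply, smul_eq_mul]
  exact Finset.sum_congr rfl fun i _ => Finset.sum_congr rfl fun j _ => mul_comm _ _

/-- The linear map with a given Choi matrix. -/
noncomputable def ofChoi {A B : FDAlg.{u}} (X : (tensor B A).alg) : A.alg →ₗ[ℂ] B.alg where
  toFun a := ⟨slice X.1 (a : Matrix A.ι A.ι ℂ), fun p q h =>
    Finset.sum_eq_zero fun i _ => Finset.sum_eq_zero fun j _ => by
      rw [X.2 (p, i) (q, j) fun e => h (congrArg Prod.fst e), zero_mul]⟩
  map_add' a a' := by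
    ext p q
    simp [slice, mul_add, Finset.sum_add_distrib]
  map_smul' c a := by
    ext p q
    simp [slice, mul_left_comm, Finset.mul_sum]

theorem choi_ofChoi {A B : FDAlg.{u}} (X : (tensor B A).alg) : choi (ofChoi X) = X := by
  ext ⟨p, i⟩ ⟨q, j⟩
  change ∑ k, ∑ m, X.1 (p, k) (q, m) * (A.unit i j : Matrix A.ι A.ι ℂ) k m = X.1 (p, i) (q, j)
  simp only [unit_apply]
  rw [Finset.sum_eq_single i, Finset.sum_eq_single j]
  · by_cases h : A.blk i = A.blk j
    · simp [h]
    · simp only [h, false_and, if_false, mul_zero]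
      exact (X.2 (p, i) (q, j) fun e => h (congrArg Prod.snd e)).symm
  · intro m _ hm; simp [hm.symm]
  · simp
  · intro k _ hk; simp [hk.symm]
  · simp

/-- Choi's theorem. -/
theorem isCP_iff {A B : FDAlg.{u}} (Φ : A.alg →ₗ[ℂ] B.alg) :
    IsCP Φ ↔ (choi Φ).1.PosSemidef := by
  constructor
  · intro h
    let e := Fintype.equivFin A.ι
    -- The Choi matrix is, up to reindexing, the image of the matrix of all matrix units.
    have h1 := h (Fintype.card A.ι) (Matrix.of fun x y => A.unit (e.symm x) (e.symm y)) ?_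
    · refine (congrArg Matrix.PosSemidef ?_).mpr
        (h1.submatrix fun x : B.ι × A.ι => (e x.2, x.1))
      ext x y
      change (Φ (A.unit x.2 y.2) : Matrix B.ι B.ι ℂ) x.1 y.1 =
        (Φ (A.unit (e.symm (e x.2)) (e.symm (e y.2))) : Matrix B.ι B.ι ℂ) x.1 y.1
      rw [e.symm_apply_apply, e.symm_apply_apply]
    · let r : A.ι → A.ι := fun i => Function.invFun A.blk (A.blk i)
      have hr : ∀ i j, A.blk i = A.blk j ↔ r i = r j := fun i j =>
        ⟨fun hij => congrArg (Function.invFun A.blk) hij, fun hij => by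
          have hi : A.blk (r i) = A.blk i := Function.invFun_eq ⟨i, rfl⟩
          have hj : A.blk (r j) = A.blk j := Function.invFun_eq ⟨j, rfl⟩
          rw [← hi, hij, hj]⟩
      let f : Fin (Fintype.card A.ι) × A.ι → ℂ := fun x => if e.symm x.1 = x.2 then 1 else 0
      refine (congrArg Matrix.PosSemidef ?_).mpr (((Matrix.PosSemidef.one (n := A.ι)
        (R := ℂ)).submatrix fun x => r (e.symm x.1)).conjTranspose_mul_mul_same
          (Matrix.diagonal f))
      ext ⟨x, i⟩ ⟨y, j⟩
      rw [Matrix.diagonal_conjTranspose, Matrix.mul_diagonal, Matrix.diagonal_mul]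
      simp only [Matrix.comp_apply, Matrix.map_apply, Matrix.of_apply, unit_apply,
        Matrix.submatrix_apply, Matrix.one_apply, hr, f, Pi.star_apply]
      by_cases h1 : e.symm x = i <;> by_cases h2 : e.symm y = j <;> simp [h1, h2]
  · intro h k M hM
    refine (congrArg Matrix.PosSemidef ?_).mpr (posSemidef_contract h hM)
    ext x y
    simp only [Matrix.comp_apply, Matrix.map_apply, coe_apply_eq_slice]
    rfl

theorem isCP_ofChoi {A B : FDAlg.{u}} {X : (tensor B A).alg} (hX : X.1.PosSemidef) :
    IsCP (ofChoi X) := by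
  rwa [isCP_iff, choi_ofChoi]

/-- As the dual of the states is `{1}`, unit trace on states already forces `ptrace X = 1`, hence
trace preservation on the whole algebra. -/
theorem mem_channels_iff {A B : FDAlg.{u}} (X : (tensor B A).alg) :
    X ∈ channels A B ↔ X.1 ∈ lift B.blk A.blk (stateSet A.blk) := by
  have key : ∀ Φ : A.alg →ₗ[ℂ] B.alg, ∀ a : A.alg, (Φ a : Matrix B.ι B.ι ℂ).trace =
      pair (ptrace (choi Φ).1) (a : Matrix A.ι A.ι ℂ) := fun Φ a => by
    rw [coe_apply_eq_slice]
    exact trace_slice _ _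
  constructor
  · rintro ⟨Φ, ⟨hcp, htr⟩, rfl⟩
    have hp : (choi Φ).1 ∈ posCone (tensor B A).blk :=
      (mem_posCone_iff _).2 ((isCP_iff Φ).1 hcp)
    refine ⟨hp, ptrace_mem_posCone hp, fun ρ hρ => ?_⟩
    have := key Φ ⟨ρ, hρ.1.1⟩
    rw [htr] at this
    exact this.symm.trans hρ.2
  · rintro ⟨hp, hd⟩
    refine ⟨ofChoi X, ⟨isCP_ofChoi hp.2, fun a => ?_⟩, (choi_ofChoi X).symm⟩
    rw [dual_stateSet] at hd
    rw [key, choi_ofChoi]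
    exact (congrArg (pair · _) hd).trans ((pair_comm _ _).trans (pair_one _))

/-- The sequence of sets obtained from the states of `B 0` by iterating `lift`, as matrices. -/
def iterLift (B : ℕ → FDAlg.{u}) :
    (n : ℕ) → Set (Matrix (tensorUpTo B n).ι (tensorUpTo B n).ι ℂ)
  | 0 => stateSet (B 0).blk
  | n + 1 => lift (B (n + 1)).blk (tensorUpTo B n).blk (iterLift B n)

theorem isRegular_iterLift (B : ℕ → FDAlg.{u}) :
    ∀ n, IsRegular (tensorUpTo B n).blk (iterLift B n)
  | 0 => isRegular_stateSet (B 0).blk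
  | n + 1 => (isRegular_iterLift B n).lift

theorem iterLift_subset_posCone (B : ℕ → FDAlg.{u}) :
    ∀ n, iterLift B n ⊆ posCone (tensorUpTo B n).blk
  | 0 => fun _ h => h.1
  | _ + 1 => fun _ h => h.1

/-- Positivity of the output is automatic, so only its trace is a constraint. -/
theorem mem_supermaps_iff (B : ℕ → FDAlg.{u}) :
    ∀ (n : ℕ) (X : (tensorUpTo B (n + 1)).alg), X ∈ supermaps B n ↔ X.1 ∈ iterLift B (n + 1)
  | 0, X => mem_channels_iff (A := B 0) (B := B 1) X
  | n + 1, X => by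
    constructor
    · rintro ⟨Φ, hcp, hS, rfl⟩
      have hp : (choi Φ).1 ∈ posCone (tensor (B (n + 2)) (tensorUpTo B (n + 1))).blk :=
        (mem_posCone_iff _).2 ((isCP_iff Φ).1 hcp)
      refine ⟨hp, ptrace_mem_posCone hp, fun Y hY => ?_⟩
      have h := (hS ⟨Y, (iterLift_subset_posCone B _ hY).1⟩ ((mem_supermaps_iff B n _).2 hY)).2
      rw [coe_apply_eq_slice] at h
      exact (trace_slice _ _).symm.trans h
    · rintro ⟨hp, hd⟩
      refine ⟨ofChoi X, isCP_ofChoi hp.2, fun Y hY => ?_, (choi_ofChoi _).symm⟩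
      have hY' := (mem_supermaps_iff B n Y).1 hY
      refine (mem_states_iff _).2 ⟨slice_mem_posCone hp (iterLift_subset_posCone B _ hY'), ?_⟩
      exact (trace_slice _ _).trans (hd.2 _ hY')

/-! ### Contracting the factor `B 0` -/

/-- The block labels of the two bracketings live in different types, so only the relation of sharing
a block can be compared. -/
theorem blk_splitFirst (B : ℕ → FDAlg.{u}) : ∀ (n : ℕ) (x y : (tensorUpTo B (n + 1)).ι),
    (tensorUpTo B (n + 1)).blk x = (tensorUpTo B (n + 1)).blk y ↔
      Prod.map (tensorUpTo (shift B) n).blk (B 0).blk (splitFirst B n x) =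
        Prod.map (tensorUpTo (shift B) n).blk (B 0).blk (splitFirst B n y)
  | 0, _, _ => Iff.rfl
  | n + 1, (p, x), (q, y) => by
    have h := blk_splitFirst B n x y
    change ((B (n + 2)).blk p, (tensorUpTo B (n + 1)).blk x) =
      ((B (n + 2)).blk q, (tensorUpTo B (n + 1)).blk y) ↔
      (((B (n + 2)).blk p, (tensorUpTo (shift B) n).blk (splitFirst B n x).1),
        (B 0).blk (splitFirst B n x).2) =
      (((B (n + 2)).blk q, (tensorUpTo (shift B) n).blk (splitFirst B n y).1),
        (B 0).blk (splitFirst B n y).2)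
    rw [Prod.mk_inj, h, Prod.mk_inj, Prod.mk_inj, Prod.ext_iff, and_assoc]
    rfl

/-- The contraction of the factor `B 0` with `ρ`. -/
def sliceFirst (B : ℕ → FDAlg.{u}) (n : ℕ)
    (X : Matrix (tensorUpTo B (n + 1)).ι (tensorUpTo B (n + 1)).ι ℂ)
    (ρ : Matrix (B 0).ι (B 0).ι ℂ) :
    Matrix (tensorUpTo (shift B) n).ι (tensorUpTo (shift B) n).ι ℂ :=
  slice (X.submatrix (splitFirst B n).symm (splitFirst B n).symm) ρ

section sliceFirst

variable (B : ℕ → FDAlg.{u}) (n : ℕ)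

theorem submatrix_splitFirst_mem_posCone
    {X : Matrix (tensorUpTo B (n + 1)).ι (tensorUpTo B (n + 1)).ι ℂ}
    (hX : X ∈ posCone (tensorUpTo B (n + 1)).blk) :
    X.submatrix (splitFirst B n).symm (splitFirst B n).symm ∈
      posCone (Prod.map (tensorUpTo (shift B) n).blk (B 0).blk) := by
  refine ⟨fun x y h => hX.1 _ _ fun e => h ?_, hX.2.submatrix _⟩
  simpa using (blk_splitFirst B n _ _).1 e

theorem sliceFirst_mem_posCone
    {X : Matrix (tensorUpTo B (n + 1)).ι (tensorUpTo B (n + 1)).ι ℂ}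
    (hX : X ∈ posCone (tensorUpTo B (n + 1)).blk) {ρ : Matrix (B 0).ι (B 0).ι ℂ}
    (hρ : ρ ∈ posCone (B 0).blk) :
    sliceFirst B n X ρ ∈ posCone (tensorUpTo (shift B) n).blk :=
  slice_mem_posCone (submatrix_splitFirst_mem_posCone B n hX) hρ

theorem sliceFirst_ptrace
    (X : Matrix (tensorUpTo B (n + 2)).ι (tensorUpTo B (n + 2)).ι ℂ)
    (ρ : Matrix (B 0).ι (B 0).ι ℂ) :
    sliceFirst B n (ptrace (β := (B (n + 2)).ι) (α := (tensorUpTo B (n + 1)).ι) X) ρ =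
      ptrace (β := (B (n + 2)).ι) (α := (tensorUpTo (shift B) n).ι)
        (sliceFirst B (n + 1) X ρ) := by
  ext x y
  change ∑ i, ∑ j, (∑ p, X (p, (splitFirst B n).symm (x, i)) (p, (splitFirst B n).symm (y, j))) *
      ρ i j = ∑ p, ∑ i, ∑ j, X (p, (splitFirst B n).symm (x, i))
        (p, (splitFirst B n).symm (y, j)) * ρ i j
  simp only [Finset.sum_mul]
  refine Eq.trans (Finset.sum_congr rfl fun i _ => ?_) Finset.sum_comm
  exact Finset.sum_comm

theorem sliceFirst_one_kronecker
    (Y : Matrix (tensorUpTo B (n + 1)).ι (tensorUpTo B (n + 1)).ι ℂ)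
    (ρ : Matrix (B 0).ι (B 0).ι ℂ) :
    sliceFirst B (n + 1) ((1 : Matrix (B (n + 2)).ι (B (n + 2)).ι ℂ) ⊗ₖ Y) ρ =
      (1 : Matrix (B (n + 2)).ι (B (n + 2)).ι ℂ) ⊗ₖ sliceFirst B n Y ρ := by
  ext ⟨p, x⟩ ⟨q, y⟩
  change ∑ i, ∑ j, (1 : Matrix (B (n + 2)).ι (B (n + 2)).ι ℂ) p q *
      Y ((splitFirst B n).symm (x, i)) ((splitFirst B n).symm (y, j)) * ρ i j =
    (1 : Matrix (B (n + 2)).ι (B (n + 2)).ι ℂ) p q *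
      ∑ i, ∑ j, Y ((splitFirst B n).symm (x, i)) ((splitFirst B n).symm (y, j)) * ρ i j
  simp only [Finset.mul_sum, mul_assoc]

theorem sliceFirst_smul (c : ℂ) (X : Matrix (tensorUpTo B (n + 1)).ι (tensorUpTo B (n + 1)).ι ℂ)
    (ρ : Matrix (B 0).ι (B 0).ι ℂ) : sliceFirst B n (c • X) ρ = c • sliceFirst B n X ρ := by
  ext x y
  simp [sliceFirst, slice, Finset.mul_sum, mul_assoc]

/-- For fixed indices in the other factors, what remains is a block-diagonal matrix over `B 0`,
which states determine. -/
theorem eq_of_sliceFirst {X Y : Matrix (tensorUpTo B (n + 1)).ι (tensorUpTo B (n + 1)).ι ℂ}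
    (hX : X ∈ posCone (tensorUpTo B (n + 1)).blk) (hY : Y ∈ posCone (tensorUpTo B (n + 1)).blk)
    (h : ∀ ρ ∈ stateSet (B 0).blk, sliceFirst B n X ρ = sliceFirst B n Y ρ) : X = Y := by
  have key : ∀ x y, (Matrix.of fun i j => X ((splitFirst B n).symm (x, i))
      ((splitFirst B n).symm (y, j))) = Matrix.of fun i j => Y ((splitFirst B n).symm (x, i))
      ((splitFirst B n).symm (y, j)) := fun x y => by
    refine eq_of_pair_states (b := (B 0).blk) (fun i j hij => ?_) fun ρ hρ =>
      congrFun (congrFun (h ρ hρ) x) y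
    have hne : Prod.map (tensorUpTo (shift B) n).blk (B 0).blk (x, i) ≠
      Prod.map (tensorUpTo (shift B) n).blk (B 0).blk (y, j) := fun e => hij (congrArg Prod.snd e)
    exact ((submatrix_splitFirst_mem_posCone B n hX).1 _ _ hne).trans
      ((submatrix_splitFirst_mem_posCone B n hY).1 _ _ hne).symm
  ext x y
  have := congrFun (congrFun (key (splitFirst B n x).1 (splitFirst B n y).1)
    (splitFirst B n x).2) (splitFirst B n y).2
  simpa using this

end sliceFirst

/-! ### Odd iterated lifts seen through states of `B 0` -/

/-- An element of `iterLift` two steps up has partial trace in `1 ⊗ iterLift`. -/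
theorem mem_iterLift_add_two (B : ℕ → FDAlg.{u}) (n : ℕ)
    {X : Matrix (tensorUpTo B (n + 2)).ι (tensorUpTo B (n + 2)).ι ℂ}
    (hX : X ∈ posCone (tensorUpTo B (n + 2)).blk) :
    X ∈ iterLift B (n + 2) ↔ ∃ Y ∈ iterLift B n,
      ptrace (β := (B (n + 2)).ι) (α := (tensorUpTo B (n + 1)).ι) X =
        (1 : Matrix (B (n + 1)).ι (B (n + 1)).ι ℂ) ⊗ₖ Y :=
  (and_iff_right hX).trans (mem_dual_lift_iff (isRegular_iterLift B n))

/-- Induction in steps of two. The base case says that a cp map is a channel exactly when it sends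
states to states. -/
theorem mem_iterLift_odd_iff (B : ℕ → FDAlg.{u}) : ∀ (m : ℕ)
    {X : Matrix (tensorUpTo B (2 * m + 1)).ι (tensorUpTo B (2 * m + 1)).ι ℂ},
    X ∈ posCone (tensorUpTo B (2 * m + 1)).blk →
    (X ∈ iterLift B (2 * m + 1) ↔
      ∀ ρ ∈ stateSet (B 0).blk, sliceFirst B (2 * m) X ρ ∈ iterLift (shift B) (2 * m))
  | 0, X, hX => by
    constructor
    · exact fun h ρ hρ => ⟨sliceFirst_mem_posCone B 0 hX hρ.1,
        (trace_slice _ _).trans (h.2.2 ρ hρ)⟩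
    · exact fun h => ⟨hX, ptrace_mem_posCone hX, fun ρ hρ =>
        (trace_slice _ _).symm.trans (h ρ hρ).2⟩
  | m + 1, X, hX => by
    have hd := card_pos_complex (β := (B (2 * m + 2)).ι)
    have hT : ptrace (β := (B (2 * m + 3)).ι) (α := (tensorUpTo B (2 * m + 2)).ι) X ∈
      posCone (tensorUpTo B (2 * m + 2)).blk := ptrace_mem_posCone hX
    have hS : ∀ ρ ∈ stateSet (B 0).blk, sliceFirst B (2 * m + 2) X ρ ∈
        posCone (tensorUpTo (shift B) (2 * m + 2)).blk := fun ρ hρ =>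
      sliceFirst_mem_posCone B _ hX hρ.1
    refine (mem_iterLift_add_two B (2 * m + 1) hX).trans ?_
    constructor
    · rintro ⟨Y, hY, hXY⟩ ρ hρ
      refine (mem_iterLift_add_two (shift B) (2 * m) (hS ρ hρ)).2
        ⟨_, (mem_iterLift_odd_iff B m (iterLift_subset_posCone B _ hY)).1 hY ρ hρ, ?_⟩
      exact (sliceFirst_ptrace B _ X ρ).symm.trans
        ((congrArg (sliceFirst B _ · ρ) hXY).trans (sliceFirst_one_kronecker B _ Y ρ))
    · intro h
      set T := ptrace (β := (B (2 * m + 3)).ι) (α := (tensorUpTo B (2 * m + 2)).ι) X with hTdef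
      -- The hypothesis gives a factor `Y'` for each `ρ` separately. Normalized partial trace
      -- defines one `Y` independent of `ρ`, whose contractions are these `Y'`.
      set Y : Matrix (tensorUpTo B (2 * m + 1)).ι (tensorUpTo B (2 * m + 1)).ι ℂ :=
        (Fintype.card (B (2 * m + 2)).ι : ℂ)⁻¹ •
          ptrace (β := (B (2 * m + 2)).ι) (α := (tensorUpTo B (2 * m + 1)).ι) T with hY
      have hYp : Y ∈ posCone (tensorUpTo B (2 * m + 1)).blk :=
        smul_mem_posCone (ptrace_mem_posCone hT) (inv_nonneg.2 hd.le)
      have key : ∀ ρ ∈ stateSet (B 0).blk, sliceFirst B (2 * m) Y ρ ∈ iterLift (shift B) (2 * m) ∧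
          sliceFirst B (2 * m + 1) T ρ = (1 : Matrix (B (2 * m + 2)).ι (B (2 * m + 2)).ι ℂ) ⊗ₖ
            sliceFirst B (2 * m) Y ρ := fun ρ hρ => by
        obtain ⟨Y', hY', e⟩ := (mem_iterLift_add_two (shift B) (2 * m) (hS ρ hρ)).1 (h ρ hρ)
        have e1 : sliceFirst B (2 * m + 1) T ρ =
            (1 : Matrix (B (2 * m + 2)).ι (B (2 * m + 2)).ι ℂ) ⊗ₖ Y' :=
          (sliceFirst_ptrace B _ X ρ).trans e
        have e2 : sliceFirst B (2 * m) Y ρ = Y' := by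
          rw [hY, sliceFirst_smul, sliceFirst_ptrace, e1]
          refine (congrArg _ (ptrace_one_kronecker Y')).trans ?_
          rw [smul_smul, inv_mul_cancel₀ hd.ne', one_smul]
        rw [e2]
        exact ⟨hY', e1⟩
      refine ⟨Y, (mem_iterLift_odd_iff B m hYp).2 fun ρ hρ => (key ρ hρ).1, ?_⟩
      refine eq_of_sliceFirst B _ hT (one_kronecker_mem_posCone _ hYp) fun ρ hρ => ?_
      exact (key ρ hρ).2.trans (sliceFirst_one_kronecker B _ Y ρ).symm

/-! ### Combs as iterated lifts -/

theorem blk_combIndex (B : ℕ → FDAlg.{u}) (n : ℕ) (x y : (tensorUpTo B (n + 2)).ι) :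
    (tensorUpTo B (n + 2)).blk x = (tensorUpTo B (n + 2)).blk y ↔
      (tensor (tensor (B (n + 2)) (B 0)) (tensorUpTo (shift B) n)).blk (combIndex B n x) =
        (tensor (tensor (B (n + 2)) (B 0)) (tensorUpTo (shift B) n)).blk (combIndex B n y) := by
  obtain ⟨p, x⟩ := x
  obtain ⟨q, y⟩ := y
  have h := blk_splitFirst B n x y
  change ((B (n + 2)).blk p, (tensorUpTo B (n + 1)).blk x) =
    ((B (n + 2)).blk q, (tensorUpTo B (n + 1)).blk y) ↔
    (((B (n + 2)).blk p, (B 0).blk (splitFirst B n x).2),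
      (tensorUpTo (shift B) n).blk (splitFirst B n x).1) =
    (((B (n + 2)).blk q, (B 0).blk (splitFirst B n y).2),
      (tensorUpTo (shift B) n).blk (splitFirst B n y).1)
  rw [Prod.mk_inj, h, Prod.mk_inj, Prod.mk_inj, Prod.ext_iff, and_assoc, and_comm (a := _ = _)]
  simp only [Prod.map_fst, Prod.map_snd]
  tauto

/-- Both sides contract `Q` with `Y` and `ρ` and trace out `B (n + 2)`; only the order of summation
differs. -/
theorem pair_ptrace_slice (B : ℕ → FDAlg.{u}) (n : ℕ)
    (Q : Matrix (tensor (tensor (B (n + 2)) (B 0)) (tensorUpTo (shift B) n)).ι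
      (tensor (tensor (B (n + 2)) (B 0)) (tensorUpTo (shift B) n)).ι ℂ)
    (Y : Matrix (tensorUpTo (shift B) n).ι (tensorUpTo (shift B) n).ι ℂ)
    (ρ : Matrix (B 0).ι (B 0).ι ℂ) :
    pair (ptrace (β := (B (n + 2)).ι) (α := (B 0).ι)
        (slice (β := (tensor (B (n + 2)) (B 0)).ι) Q Y)) ρ =
      pair (ptrace (β := (B (n + 2)).ι) (α := (tensorUpTo (shift B) n).ι)
        (sliceFirst B (n + 1) (Q.submatrix (combIndex B n) (combIndex B n)) ρ)) Y := by
  have h : ∀ p x i, combIndex B n (p, (splitFirst B n).symm (x, i)) = ((p, i), x) :=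
    fun p x i => by
      change ((p, (splitFirst B n ((splitFirst B n).symm (x, i))).2),
        (splitFirst B n ((splitFirst B n).symm (x, i))).1) = ((p, i), x)
      rw [Equiv.apply_symm_apply]
  change ∑ i, ∑ j, (∑ p, ∑ x, ∑ y, Q ((p, i), x) ((p, j), y) * Y x y) * ρ i j =
    ∑ x, ∑ y, (∑ p, ∑ i, ∑ j, Q (combIndex B n (p, (splitFirst B n).symm (x, i)))
      (combIndex B n (p, (splitFirst B n).symm (y, j))) * ρ i j) * Y x y
  simp only [h, Finset.sum_mul]
  simp only [← Fintype.sum_prod_type']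
  -- The index permutation `(i, j, p, x, y) ↦ (x, y, p, i, j)` has an inverse given by the same
  -- formula.
  refine Fintype.sum_equiv
    ⟨fun z => (z.2.2.2.1, z.2.2.2.2, z.2.2.1, z.1, z.2.1),
      fun z => (z.2.2.2.1, z.2.2.2.2, z.2.2.1, z.1, z.2.1), fun _ => rfl, fun _ => rfl⟩ _ _
    fun z => ?_
  exact mul_right_comm _ _ _

/-- The induction hypothesis is applied to `shift B`, so `B` must vary. For each state `ρ`, trace
one on all shorter combs `Y` says that the contraction of `X` by `ρ` is a lift of the shifted
iterated lift. -/
theorem mem_combs_iff : ∀ (k : ℕ) (B : ℕ → FDAlg.{u}) (X : (tensorUpTo B (2 * k + 1)).alg),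
    X ∈ combs k B ↔ X.1 ∈ iterLift B (2 * k + 1)
  | 0, B, X => mem_channels_iff (A := B 0) (B := B 1) X
  | k + 1, B, X => by
    constructor
    · rintro ⟨Φ, hcp, hC, hX⟩
      have hp : X.1 ∈ posCone (tensorUpTo B (2 * k + 3)).blk :=
        (mem_posCone_iff X).2 (hX ▸ ((isCP_iff Φ).1 hcp).submatrix _)
      refine (mem_iterLift_odd_iff B (k + 1) hp).2 fun ρ hρ => ?_
      have hs := sliceFirst_mem_posCone B _ hp hρ.1
      refine ⟨hs, ptrace_mem_posCone hs, fun Y hY => ?_⟩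
      have h := ((mem_channels_iff _).1 (hC ⟨Y, (iterLift_subset_posCone _ _ hY).1⟩
        ((mem_combs_iff k (shift B) _).2 hY))).2.2 ρ hρ
      rw [coe_apply_eq_slice] at h
      refine Eq.trans ?_ ((pair_ptrace_slice B (2 * k + 1) (choi Φ).1 Y ρ).symm.trans h)
      rw [← hX]
      rfl
    · intro h
      have hp : X.1 ∈ posCone (tensorUpTo B (2 * k + 3)).blk := iterLift_subset_posCone B _ h
      let e := combIndex B (2 * k + 1)
      let Q : (tensor (tensor (B (2 * k + 3)) (B 0)) (tensorUpTo (shift B) (2 * k + 1))).alg :=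
        ⟨X.1.submatrix e.symm e.symm, fun x y hxy => X.2 _ _ fun he => hxy (by
          simpa [e] using (blk_combIndex B (2 * k + 1) _ _).1 he)⟩
      have hQ : Q.1.PosSemidef := hp.2.submatrix _
      have hQX : Q.1.submatrix e e = X.1 := by
        ext x y
        simp [Q]
      refine ⟨ofChoi Q, isCP_ofChoi hQ, fun Y hY => ?_, by rw [choi_ofChoi]; exact hQX.symm⟩
      have hY' := (mem_combs_iff k (shift B) Y).1 hY
      have hY'' := slice_mem_posCone ((mem_posCone_iff Q).2 hQ) (iterLift_subset_posCone _ _ hY')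
      refine (mem_channels_iff _).2 ⟨hY'', ptrace_mem_posCone hY'', fun ρ hρ => ?_⟩
      refine (pair_ptrace_slice B (2 * k + 1) Q.1 Y.1 ρ).trans ?_
      rw [hQX]
      exact ((mem_iterLift_odd_iff B (k + 1) hp).1 h ρ hρ).2.2 _ hY'

end FDAlg

/-- For every `N = k + 1 ≥ 1`, the quantum `N`-combs on `B 0, …, B (2 * N - 1)` are exactly the
generalized supermaps `𝒞(B 0, …, B (2 * N - 1))`. -/
theorem mainTheorem5 (B : ℕ → FDAlg.{u}) (k : ℕ) :
    FDAlg.combs k B = FDAlg.supermaps B (2 * k) := by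
  ext X
  exact (FDAlg.mem_combs_iff k B X).trans (FDAlg.mem_supermaps_iff B (2 * k) X).symm
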